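/- Let $a>-1$ and $\theta>0$ be real numbers and write $\mathbb{R}_+=(0,\infty)$. For an integer $N\ge 0$ define the partition function of the $\theta$-deformed Bures ensemble $$Z_N^B(a;\theta)=\frac1{N!}\int_{\mathbb{R}_+^N}\ \prod_{1\le j<k\le N}\frac{x_k-x_j}{x_k+x_j}\,(x_k^\theta-x_j^\theta)\ \prod_{j=1}^N x_j^a e^{-x_j}\,dx_j$$ and, for real $b$, the partition function of the $\theta$-deformed Cauchy--Laguerre two-matrix model $$Z_N^C(a,b;\theta)=\frac1{(N!)^2}\int_{\mathbb{R}_+^N\times\mathbb{R}_+^N}\ \prod_{j=1}^N x_j^a e^{-x_j}y_j^b e^{-y_j}\ \frac{\prod_{1\le j<k\le N}(x_k-x_j)(y_k-y_j)}{\prod_{j,k=1}^N(x_j+y_k)}\ \prod_{1\le j<k\le N}(x_k^\theta-x_j^\theta)(y_k^\theta-y_j^\theta)\,dx\,dy .$$ Then, for every $N\ge 0$, the integrals defining $Z_N^B(a;\theta)$ and $Z_N^C(a,a+1;\theta)$ converge absolutely, and $$\bigl(Z_N^B(a;\theta)\bigr)^2=2^N\,Z_N^C(a,a+1;\theta).$$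 Moreover, for all integers $j,k\ge 1$ the integrals $$I^C_{j,k}=\int_{\mathbb{R}_+^2}\frac{x^{a+\theta(j-1)}y^{a+1+\theta(k-1)}}{x+y}e^{-(x+y)}\,dx\,dy,\qquad I^B_{j,k}=\int_{\mathbb{R}_+^2}\frac{y-x}{y+x}\,x^{a+\theta(j-1)}y^{a+\theta(k-1)}e^{-(x+y)}\,dx\,dy,\qquad i^B_j=\int_{\mathbb{R}_+}x^{a+\theta(j-1)}e^{-x}\,dx$$ converge absolutely and satisfy $$2I^C_{j,k}=I^B_{j,k}+i^B_j\,i^B_k .$$ -/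

import Mathlib

open MeasureTheory

noncomputable section

namespace ThetaEnsemble

/-- The open orthant `(0,∞)^N`. -/
def orthant (N : ℕ) : Set (Fin N → ℝ) :=
  Set.univ.pi fun _ => Set.Ioi 0

/-- The open quadrant `(0,∞)²`. -/
def quadrant : Set (ℝ × ℝ) :=
  Set.Ioi 0 ×ˢ Set.Ioi 0

/-- The unnormalised density of the `θ`-deformed Bures ensemble with Laguerre weight. -/
def buresDensity (N : ℕ) (a θ : ℝ) (x : Fin N → ℝ) : ℝ :=
  (∏ j, ∏ k ∈ Finset.Ioi j, (x k - x j) / (x k + x j) * (x k ^ θ - x j ^ θ)) *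
    ∏ j, x j ^ a * Real.exp (-x j)

/-- The unnormalised density of the `θ`-deformed Cauchy–Laguerre two-matrix model. -/
def cauchyDensity (N : ℕ) (a b θ : ℝ) (p : (Fin N → ℝ) × (Fin N → ℝ)) : ℝ :=
  (∏ j, p.1 j ^ a * Real.exp (-p.1 j) * (p.2 j ^ b * Real.exp (-p.2 j))) *
    ((∏ j, ∏ k ∈ Finset.Ioi j, (p.1 k - p.1 j) * (p.2 k - p.2 j)) /
      ∏ j, ∏ k, (p.1 j + p.2 k)) *
    ∏ j, ∏ k ∈ Finset.Ioi j, (p.1 k ^ θ - p.1 j ^ θ) * (p.2 k ^ θ - p.2 j ^ θ)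

/-- The Bures partition function `Z_N^B(a;θ)`. -/
def buresZ (N : ℕ) (a θ : ℝ) : ℝ :=
  1 / (N.factorial : ℝ) * ∫ x in orthant N, buresDensity N a θ x

/-- The Cauchy–Laguerre partition function `Z_N^C(a,b;θ)`. -/
def cauchyZ (N : ℕ) (a b θ : ℝ) : ℝ :=
  (1 / (N.factorial : ℝ)) ^ 2 *
    ∫ p in orthant N ×ˢ orthant N, cauchyDensity N a b θ p

/-- Integrand of the bimoment `I^C_{j,k}(a,b;θ)`, with indices `j, k` starting from `1`. -/
def cauchyMomentIntegrand (a b θ : ℝ) (j k : ℕ) (p : ℝ × ℝ) : ℝ :=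
  p.1 ^ (a + θ * ((j : ℝ) - 1)) * p.2 ^ (b + θ * ((k : ℝ) - 1)) / (p.1 + p.2) *
    Real.exp (-(p.1 + p.2))

/-- Integrand of the bimoment `I^B_{j,k}(a;θ)`, with indices `j, k` starting from `1`. -/
def buresMomentIntegrand (a θ : ℝ) (j k : ℕ) (p : ℝ × ℝ) : ℝ :=
  (p.2 - p.1) / (p.2 + p.1) *
    (p.1 ^ (a + θ * ((j : ℝ) - 1)) * p.2 ^ (a + θ * ((k : ℝ) - 1))) *
    Real.exp (-(p.1 + p.2))

/-- Integrand of the single moment `i^B_j(a;θ)`, with the index `j` starting from `1`. -/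
def buresSingleIntegrand (a θ : ℝ) (j : ℕ) (x : ℝ) : ℝ :=
  x ^ (a + θ * ((j : ℝ) - 1)) * Real.exp (-x)

/-- The bimoment `I^C_{j,k}(a,b;θ)`. -/
def cauchyMoment (a b θ : ℝ) (j k : ℕ) : ℝ :=
  ∫ p in quadrant, cauchyMomentIntegrand a b θ j k p

/-- The bimoment `I^B_{j,k}(a;θ)`. -/
def buresMoment (a θ : ℝ) (j k : ℕ) : ℝ :=
  ∫ p in quadrant, buresMomentIntegrand a θ j k p

/-- The single moment `i^B_j(a;θ)`. -/
def buresSingleMoment (a θ : ℝ) (j : ℕ) : ℝ :=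
  ∫ x in Set.Ioi (0 : ℝ), buresSingleIntegrand a θ j x

end ThetaEnsemble

end

open MeasureTheory

noncomputable section

namespace ThetaEnsemble

/-! Both sides equal one `N × N` determinant. Put `f_i(x) = x^(a+θi) e^(-x)` for `0 ≤ i < N`, and
`S(x,y) = (y-x)/(y+x)`. The link between the models is `2y/(x+y) = 1 + S(x,y)`: integrated against
`f_i(x) f_j(y)`, it gives the bimoment relation.

Cauchy side: since `b = a+1`, the weight supplies `∏ y_j`. With `2^N` and the Cauchy determinant
this makes `det[2y_k/(x_j+y_k)]`, while the `θ`-differences are Vandermonde determinants. Andréief's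
identity (`integral_det_kernel_mul_det`) then yields `det(B + ℓℓᵀ)`, where `B_ij = ∬ S f_i f_j` and
`ℓ_i = ∫ f_i`.

Bures side: antisymmetry reduces `Z_N^B` to `∫ ∏_{i<j} S(x_i,x_j) ∏ f_i(x_i)`. By Schur's Pfaffian
identity this is morally the Pfaffian of `B`, bordered by `ℓ` when `N` is odd. Its square is `det(B
+ ℓℓᵀ)` in either parity.

Pfaffians are never defined. Only the row expansion of Schur's product is used
(`pairProd_schurKernel_expand`, by partial fractions); it integrates to a recursion for alternating
forms, and `sq_eq_det_of_pfaffian_expansion` shows that any such recursion squares to the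
determinant. -/

open Finset Polynomial in
/-- The partial fraction expansion of `∏ j, (y j - t) / (y j + t)`; the constant term is
determined by comparing `t = 0` with `t → ∞`. -/
theorem prod_sub_div_add_eq_sum {m : ℕ} (y : Fin m → ℝ) (hy : ∀ i, 0 < y i)
    (hinj : Function.Injective y) {t : ℝ} (ht : 0 < t) :
    ∏ j, (y j - t) / (y j + t) = (if Even m then 1 else 0) +
      ∑ j, (y j - t) / (y j + t) * ∏ k ∈ univ.erase j, (y k + y j) / (y k - y j) := by
  set w : Fin m → ℝ := fun j => ∏ k ∈ univ.erase j, (y k + y j) / (y k - y j) with hw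
  -- Clearing denominators by `D`, the claim becomes `P = Q + c D` for a constant `c`.
  let D : ℝ[X] := ∏ j, (C (y j) + X)
  let P : ℝ[X] := ∏ j, (C (y j) - X)
  let Q : ℝ[X] := ∑ j, C (w j) * ((C (y j) - X) * ∏ k ∈ univ.erase j, (C (y k) + X))
  have hadd : ∀ c : ℝ, (C c + X).natDegree ≤ 1 := fun c => by compute_degree
  have hsub : ∀ c : ℝ, (C c - X).natDegree ≤ 1 := fun c => by compute_degree
  have hDdeg : D.natDegree ≤ m := by
    refine (natDegree_prod_le _ _).trans ?_
    exact (sum_le_sum fun j _ => hadd (y j)).trans (by simp)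
  have hPdeg : P.natDegree ≤ m := by
    refine (natDegree_prod_le _ _).trans ?_
    exact (sum_le_sum fun j _ => hsub (y j)).trans (by simp)
  have hQdeg : Q.natDegree ≤ m := by
    refine natDegree_sum_le_of_forall_le _ _ fun j _ => ?_
    refine (natDegree_C_mul_le _ _).trans (natDegree_mul_le.trans ?_)
    have h1 : (∏ k ∈ univ.erase j, (C (y k) + X)).natDegree ≤ m - 1 := by
      refine (natDegree_prod_le _ _).trans ?_
      refine (sum_le_sum fun k _ => hadd (y k)).trans ?_
      simp [card_erase_of_mem]
    have h2 := hsub (y j)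
    have h3 := j.pos
    omega
  have hD : ∀ s : ℝ, D.eval s = ∏ j, (y j + s) := fun s => by simp [D, eval_prod]
  have hP : ∀ s : ℝ, P.eval s = ∏ j, (y j - s) := fun s => by simp [P, eval_prod]
  have hQ : ∀ s : ℝ, Q.eval s = ∑ j, w j * ((y j - s) * ∏ k ∈ univ.erase j, (y k + s)) :=
    fun s => by simp [Q, eval_finsetSum, eval_prod]
  have hD0 : D.eval 0 ≠ 0 := by
    rw [hD]; exact prod_ne_zero_iff.2 fun j _ => by simpa using (hy j).ne'
  -- This `c` forces a root at `0`. The points `-y j` are roots for any `c`, so a polynomial of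
  -- degree at most `m` has `m + 1` roots.
  set c : ℝ := (P.eval 0 - Q.eval 0) / D.eval 0 with hc
  have hG : P - Q - C c * D = 0 := by
    refine eq_zero_of_degree_lt_of_eval_finset_eq_zero (insert 0 (univ.image fun j => -y j)) ?_ ?_
    · rw [card_insert_of_notMem (by simpa using fun j => (hy j).ne'),
        card_image_of_injective _ fun i j h => hinj (neg_injective h), card_univ, Fintype.card_fin]
      refine lt_of_le_of_lt degree_le_natDegree ?_
      have : (P - Q - C c * D).natDegree ≤ m :=
        (natDegree_sub_le_of_le (natDegree_sub_le_of_le hPdeg hQdeg)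
          ((natDegree_C_mul_le _ _).trans hDdeg)).trans (by simp)
      exact_mod_cast Nat.lt_succ_of_le this
    · intro s hs
      rcases mem_insert.1 hs with rfl | hs
      · simp only [eval_sub, eval_mul, eval_C]
        rw [hc]; field_simp; ring
      · obtain ⟨j, -, rfl⟩ := mem_image.1 hs
        have h1 : D.eval (-y j) = 0 := by
          rw [hD]; exact prod_eq_zero (mem_univ j) (by ring)
        have h2 : Q.eval (-y j) = w j * ((y j + y j) * ∏ k ∈ univ.erase j, (y k - y j)) := by
          rw [hQ, sum_eq_single j]
          · simp [sub_eq_add_neg]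
          · intro i _ hi
            rw [prod_eq_zero (mem_erase.2 ⟨hi.symm, mem_univ j⟩) (by ring)]; ring
          · simp
        have h3 : P.eval (-y j) = (y j + y j) * ∏ k ∈ univ.erase j, (y k + y j) := by
          rw [hP, ← mul_prod_erase _ _ (mem_univ j)]; simp
        have h4 : w j * ∏ k ∈ univ.erase j, (y k - y j) = ∏ k ∈ univ.erase j, (y k + y j) := by
          rw [hw, ← prod_mul_distrib]
          refine prod_congr rfl fun k hk => ?_
          have : y k - y j ≠ 0 := sub_ne_zero.2 fun h => (mem_erase.1 hk).1 (hinj h)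
          field_simp
        simp only [eval_sub, eval_mul, eval_C, h1, h2, h3]
        rw [← h4]; ring
  have key : ∀ s : ℝ, 0 ≤ s →
      ∏ j, (y j - s) / (y j + s) - ∑ j, (y j - s) / (y j + s) * w j = c := by
    intro s hs
    have hne : ∀ j, y j + s ≠ 0 := fun j => (add_pos_of_pos_of_nonneg (hy j) hs).ne'
    have hDs : ∏ j, (y j + s) ≠ 0 := prod_ne_zero_iff.2 fun j _ => hne j
    have h := congrArg (eval s) hG
    simp only [eval_sub, eval_mul, eval_C, eval_zero, hP, hQ, hD] at h
    have h1 : ∑ j, (y j - s) / (y j + s) * w j =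
        (∑ j, w j * ((y j - s) * ∏ k ∈ univ.erase j, (y k + s))) / ∏ j, (y j + s) := by
      rw [sum_div]
      refine sum_congr rfl fun j _ => ?_
      rw [← mul_prod_erase univ (fun k => y k + s) (mem_univ j)]
      have := hne j
      have h2 : ∏ k ∈ univ.erase j, (y k + s) ≠ 0 := prod_ne_zero_iff.2 fun k _ => hne k
      field_simp
    rw [prod_div_distrib, h1, ← sub_div, div_eq_iff hDs]
    linarith
  have hlim : ∀ j, Filter.Tendsto (fun s : ℝ => (y j - s) / (y j + s)) Filter.atTop (nhds (-1)) := by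
    intro j
    have h1 : Filter.Tendsto (fun s : ℝ => 2 * y j / (y j + s)) Filter.atTop (nhds 0) :=
      Filter.Tendsto.div_atTop tendsto_const_nhds (Filter.tendsto_atTop_add_const_left _ _ Filter.tendsto_id)
    have h2 := h1.add_const (-1)
    rw [zero_add] at h2
    refine h2.congr' ?_
    filter_upwards [Filter.eventually_ge_atTop 0] with s hs
    have : y j + s ≠ 0 := (add_pos_of_pos_of_nonneg (hy j) hs).ne'
    field_simp
    ring
  have hinf : c = (-1) ^ m + ∑ j, w j := by
    have h1 : Filter.Tendsto (fun s : ℝ => ∏ j, (y j - s) / (y j + s) -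
        ∑ j, (y j - s) / (y j + s) * w j) Filter.atTop
        (nhds (∏ _j : Fin m, (-1 : ℝ) - ∑ j, (-1) * w j)) :=
      (tendsto_finsetProd _ fun j _ => hlim j).sub
        (tendsto_finsetSum _ fun j _ => (hlim j).mul_const _)
    have h2 := tendsto_nhds_unique ((tendsto_const_nhds (x := c)).congr' ?_) h1
    · simpa using h2
    · filter_upwards [Filter.eventually_ge_atTop 0] with s hs using (key s hs).symm
  have hzero : c = 1 - ∑ j, w j := by
    rw [← key 0 le_rfl]
    simp [div_self (hy _).ne']
  -- Adding the values at `0` and at infinity eliminates `∑ w j`: `2c = 1 + (-1)^m`.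
  have hce : c = if Even m then 1 else 0 := by
    split_ifs with h
    · rw [h.neg_one_pow] at hinf; linarith
    · rw [(Nat.not_even_iff_odd.1 h).neg_one_pow] at hinf; linarith
  rw [← hce, ← key t ht.le]; ring

/-! ### Products over pairs and the Schur Pfaffian expansion -/

section PairProd

variable {X : Type*}

/-- The product of `S (x i) (x j)` over all pairs `i < j`. -/
def pairProd (S : X → X → ℝ) {n : ℕ} (x : Fin n → X) : ℝ :=
  ∏ i, ∏ j ∈ Finset.Ioi i, S (x i) (x j)

theorem pairProd_succ (S : X → X → ℝ) {n : ℕ} (x : Fin (n + 1) → X) :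
    pairProd S x = (∏ j : Fin n, S (x 0) (x j.succ)) * pairProd S (fun j : Fin n => x j.succ) := by
  simp [pairProd, Fin.prod_univ_succ]

theorem pairProd_comp_perm {S : X → X → ℝ} (hS : ∀ x y, S x y = -S y x) {n : ℕ}
    (σ : Equiv.Perm (Fin n)) (x : Fin n → X) :
    pairProd S (x ∘ σ) = (Equiv.Perm.sign σ : ℤ) * pairProd S x :=
  σ.prod_Ioi_comp_eq_sign_mul_prod (f := fun i j => S (x i) (x j)) fun _ _ => hS _ _

theorem pairProd_eq_extract {S : X → X → ℝ} (hS : ∀ x y, S x y = -S y x) {n : ℕ}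
    (x : Fin (n + 1) → X) (j : Fin (n + 1)) :
    pairProd S x = (-1) ^ (j : ℕ) * (∏ k : Fin n, S (x j) (x (j.succAbove k))) *
      pairProd S (fun k => x (j.succAbove k)) := by
  -- This cycle brings index `j` to the front, keeps the order of the others, and has sign `(-1)^j`.
  have h := pairProd_comp_perm hS j.cycleRange.symm x
  rw [pairProd_succ] at h
  simp only [Function.comp_apply, Fin.cycleRange_symm_zero, Fin.cycleRange_symm_succ,
    Equiv.Perm.sign_symm, Fin.sign_cycleRange] at h
  push_cast at h
  rw [mul_assoc, h, ← mul_assoc, ← mul_pow]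
  simp

theorem abs_pairProd_le_one {S : X → X → ℝ} (hS : ∀ x y, |S x y| ≤ 1) {n : ℕ} (x : Fin n → X) :
    |pairProd S x| ≤ 1 := by
  rw [pairProd, Finset.abs_prod]
  refine Finset.prod_le_one (fun _ _ => abs_nonneg _) fun i _ => ?_
  rw [Finset.abs_prod]
  exact Finset.prod_le_one (fun _ _ => abs_nonneg _) fun j _ => hS _ _

theorem measurable_pairProd [MeasurableSpace X] {S : X → X → ℝ}
    (hS : Measurable (Function.uncurry S)) (n : ℕ) :
    Measurable (pairProd S : (Fin n → X) → ℝ) := by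
  refine Finset.measurable_prod _ fun i _ => Finset.measurable_prod _ fun j _ => ?_
  exact hS.comp (g := Function.uncurry S) (f := fun x : Fin n → X => (x i, x j))
    ((measurable_pi_apply i).prodMk (measurable_pi_apply j))

end PairProd

/-- The kernel `(y - x) / (y + x)`, extended to a bounded antisymmetric kernel on the plane. -/
def schurKernel (x y : ℝ) : ℝ := (y - x) / (|x| + |y|)

theorem schurKernel_of_pos {x y : ℝ} (hx : 0 < x) (hy : 0 < y) :
    schurKernel x y = (y - x) / (y + x) := by
  rw [schurKernel, abs_of_pos hx, abs_of_pos hy, add_comm]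

theorem schurKernel_antisymm (x y : ℝ) : schurKernel x y = -schurKernel y x := by
  rw [schurKernel, schurKernel, add_comm |y|]; ring

theorem abs_schurKernel_le_one (x y : ℝ) : |schurKernel x y| ≤ 1 := by
  rw [schurKernel, abs_div, abs_of_nonneg (add_nonneg (abs_nonneg x) (abs_nonneg y))]
  refine div_le_one_of_le₀ ?_ (by positivity)
  rw [add_comm]; exact abs_sub y x

theorem measurable_schurKernel : Measurable (Function.uncurry schurKernel) := by
  unfold Function.uncurry schurKernel
  fun_prop

/-- The expansion of the Schur Pfaffian along its first row, for an even or odd number of points. -/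
theorem pairProd_schurKernel_expand {n : ℕ} (x : Fin (n + 2) → ℝ) (hx : ∀ i, 0 < x i)
    (hinj : Function.Injective x) :
    pairProd schurKernel x =
      ∑ j : Fin (n + 1), (-1) ^ (j : ℕ) * schurKernel (x 0) (x j.succ) *
          pairProd schurKernel (fun k : Fin n => x (j.succAbove k).succ) +
        if Odd n then pairProd schurKernel (fun k : Fin (n + 1) => x k.succ) else 0 := by
  -- Here `t = x 0` and the remaining `m = n + 1` points are the `y j`, so the constant term
  -- survives exactly for odd `n`.
  have hpf := prod_sub_div_add_eq_sum (fun j : Fin (n + 1) => x j.succ) (fun _ => hx _)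
    (hinj.comp (Fin.succ_injective _)) (hx 0)
  have h0 : ∀ j : Fin (n + 1), schurKernel (x 0) (x j.succ) =
      (x j.succ - x 0) / (x j.succ + x 0) := fun j => schurKernel_of_pos (hx _) (hx _)
  rw [pairProd_succ, Finset.prod_congr rfl fun j _ => h0 j, hpf, add_mul, Finset.sum_mul, add_comm]
  congr 1
  · refine Finset.sum_congr rfl fun j _ => ?_
    rw [h0, pairProd_eq_extract schurKernel_antisymm (fun k : Fin (n + 1) => x k.succ) j]
    -- The partial fraction coefficient cancels every factor of the tail product that involves `x
    -- j.succ`.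
    have h1 : (∏ k ∈ Finset.univ.erase j, (x k.succ + x j.succ) / (x k.succ - x j.succ)) *
        ∏ k : Fin n, schurKernel (x j.succ) (x (j.succAbove k).succ) = 1 := by
      have : Finset.univ.erase j = Finset.univ.map j.succAboveEmb := by
        ext k; simp [Fin.exists_succAbove_eq_iff]
      rw [this, Finset.prod_map, ← Finset.prod_mul_distrib]
      refine Finset.prod_eq_one fun k _ => ?_
      rw [schurKernel_of_pos (hx _) (hx _)]
      have h2 : x (j.succAbove k).succ - x j.succ ≠ 0 := sub_ne_zero.2 fun h =>
        Fin.succAbove_ne j k (Fin.succ_injective _ (hinj h))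
      have h3 := (add_pos (hx (j.succAbove k).succ) (hx j.succ)).ne'
      simp only [Fin.coe_succAboveEmb]
      field_simp
    linear_combination ((x j.succ - x 0) / (x j.succ + x 0) * (-1) ^ (j : ℕ) *
      pairProd schurKernel (fun k : Fin n => x (j.succAbove k).succ)) * h1
  · simp only [Nat.even_add_one, Nat.not_even_iff_odd, ite_mul, one_mul, zero_mul]

/-! ### The Cauchy determinant -/

/-- The Cauchy determinant. -/
theorem det_cauchy {n : ℕ} (x y : Fin n → ℝ) (h : ∀ i j, x i + y j ≠ 0) :
    (Matrix.of fun i j => (x i + y j)⁻¹).det =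
      (∏ i, ∏ j ∈ Finset.Ioi i, (x j - x i) * (y j - y i)) / ∏ i, ∏ j, (x i + y j) := by
  induction n with
  | zero => simp
  | succ n ih =>
    -- Row `0` clears the rest of column `0`; the remaining minor is a smaller Cauchy matrix with
    -- rescaled rows and columns.
    let B : Matrix (Fin (n + 1)) (Fin (n + 1)) ℝ := Matrix.of fun i j =>
      (x i + y j)⁻¹ - (if i = 0 then 0 else (x 0 + y 0) / (x i + y 0)) * (x 0 + y j)⁻¹
    rw [Matrix.det_eq_of_forall_row_eq_smul_add_const (B := B)
      (fun i => if i = 0 then 0 else (x 0 + y 0) / (x i + y 0)) 0 (by simp)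
      (fun i j => by simp [B])]
    rw [Matrix.det_succ_column_zero, Fin.sum_univ_succ, Finset.sum_eq_zero (s := Finset.univ)]
    · have hB : B.submatrix (Fin.succAbove 0) Fin.succ = Matrix.of fun i j =>
          ((x i.succ - x 0) / (x i.succ + y 0)) *
            (((y j.succ - y 0) / (x 0 + y j.succ)) * (x i.succ + y j.succ)⁻¹) := by
        ext i j
        have h1 := h i.succ j.succ
        have h2 := h i.succ 0
        have h3 := h 0 j.succ
        simp only [B, Matrix.submatrix_apply, Matrix.of_apply, Fin.zero_succAbove,
          Fin.succ_ne_zero, if_false]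
        field_simp
        ring
      have hdet : (Matrix.of fun i j : Fin n => ((x i.succ - x 0) / (x i.succ + y 0)) *
            (((y j.succ - y 0) / (x 0 + y j.succ)) * (x i.succ + y j.succ)⁻¹)).det =
          (∏ i : Fin n, (x i.succ - x 0) / (x i.succ + y 0)) *
            ((∏ j : Fin n, (y j.succ - y 0) / (x 0 + y j.succ)) *
              (Matrix.of fun i j : Fin n => (x i.succ + y j.succ)⁻¹).det) := by
        rw [← Matrix.det_mul_row, ← Matrix.det_mul_column]
        rfl
      have hB0 : B 0 0 = (x 0 + y 0)⁻¹ := by simp [B]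
      rw [hB, hdet, hB0, ih _ _ fun i j => h _ _]
      simp only [Fin.prod_univ_succ, Fin.prod_Ioi_zero, Fin.prod_Ioi_succ, Finset.prod_mul_distrib,
        Finset.prod_div_distrib, Fin.val_zero, pow_zero, one_mul, add_zero]
      have h0 := h 0 0
      have h1 : ∏ i : Fin n, (x i.succ + y 0) ≠ 0 := Finset.prod_ne_zero_iff.2 fun i _ => h _ _
      have h2 : ∏ j : Fin n, (x 0 + y j.succ) ≠ 0 := Finset.prod_ne_zero_iff.2 fun i _ => h _ _
      have h3 : ∏ i : Fin n, ∏ j : Fin n, (x i.succ + y j.succ) ≠ 0 :=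
        Finset.prod_ne_zero_iff.2 fun i _ => Finset.prod_ne_zero_iff.2 fun j _ => h _ _
      field_simp
    · intro i _
      have := h i.succ 0
      have := h 0 0
      simp [B]
      field_simp
      simp

/-! ### Pfaffian recursions square to determinants -/

theorem exists_perm_map_zero_map_one {n : ℕ} {i j : Fin (n + 2)} (h : i ≠ j) :
    ∃ σ : Equiv.Perm (Fin (n + 2)), σ 0 = i ∧ σ 1 = j := by
  refine ⟨Equiv.swap 0 i * Equiv.swap 1 (Equiv.swap 0 i j), ?_, ?_⟩
  · have h1 : (0 : Fin (n + 2)) ≠ Equiv.swap 0 i j := by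
      intro h0
      have := congrArg (Equiv.swap 0 i) h0
      simp at this
      exact h this
    simp [Equiv.swap_apply_of_ne_of_ne (show (0 : Fin (n + 2)) ≠ 1 by simp) h1]
  · simp

/-- The `2 × 2` block of a nondegenerate pair splits off the determinant of a skew matrix
plus a rank one matrix. -/
theorem det_hyperbolic_block {n : ℕ} (G : Matrix (Fin (n + 2)) (Fin (n + 2)) ℝ)
    (u : Fin (n + 2) → ℝ) {a : ℝ} (ha : a ≠ 0)
    (h00 : G 0 0 = u 0 * u 0) (h01 : G 0 1 = a + u 0 * u 1) (h10 : G 1 0 = -a + u 1 * u 0)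
    (h11 : G 1 1 = u 1 * u 1)
    (h0 : ∀ k : Fin n, G 0 k.succ.succ = u 0 * u k.succ.succ)
    (h1 : ∀ k : Fin n, G 1 k.succ.succ = u 1 * u k.succ.succ)
    (h0' : ∀ k : Fin n, G k.succ.succ 0 = u k.succ.succ * u 0)
    (h1' : ∀ k : Fin n, G k.succ.succ 1 = u k.succ.succ * u 1) :
    G.det = a ^ 2 * (G.submatrix (fun k : Fin n => k.succ.succ) fun k => k.succ.succ).det := by
  let e : Fin 2 ⊕ Fin n ≃ Fin (n + 2) := finSumFinEquiv.trans (finCongr (add_comm 2 n))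
  have e0 : e (Sum.inl 0) = 0 := rfl
  have e1 : e (Sum.inl 1) = 1 := by ext; simp [e]
  have e2 : ∀ k, e (Sum.inr k) = k.succ.succ := fun k => by ext; simp [e]
  let A : Matrix (Fin 2) (Fin 2) ℝ := !![u 0 * u 0, a + u 0 * u 1; -a + u 1 * u 0, u 1 * u 1]
  let B : Matrix (Fin 2) (Fin n) ℝ := Matrix.of fun i k => ![u 0, u 1] i * u k.succ.succ
  let C : Matrix (Fin n) (Fin 2) ℝ := Matrix.of fun k i => u k.succ.succ * ![u 0, u 1] i
  let D : Matrix (Fin n) (Fin n) ℝ := G.submatrix (fun k => k.succ.succ) fun k => k.succ.succ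
  -- Rows of `Y` are proportional to `(u 1, -u 0)`, hence annihilate `(u 0, u 1)`. So `Y` clears the
  -- block `C` without altering `D`, and `det A = a ^ 2`.
  let Y : Matrix (Fin n) (Fin 2) ℝ := Matrix.of fun k i => u k.succ.succ * ![u 1 / a, -u 0 / a] i
  have hG : G.submatrix e e = Matrix.fromBlocks A B C D := by
    ext i j
    rcases i with i | i <;> rcases j with j | j
    · fin_cases i <;> fin_cases j <;> simp [A, e0, e1, h00, h01, h10, h11]
    · fin_cases i <;> simp [B, e0, e1, e2, h0, h1]
    · fin_cases j <;> simp [C, e0, e1, e2, h0', h1']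
    · simp [D, e2]
  have hYA : Y * A = C := by
    ext k i
    fin_cases i <;> simp [Matrix.mul_apply, Fin.sum_univ_two, Y, A, C] <;> field_simp <;> ring
  have hYB : Y * B = 0 := by
    ext k i
    simp [Matrix.mul_apply, Fin.sum_univ_two, Y, B]
    field_simp
    ring
  have hmul : Matrix.fromBlocks 1 0 (-Y) 1 * Matrix.fromBlocks A B C D =
      Matrix.fromBlocks A B 0 D := by
    simp [Matrix.fromBlocks_multiply, hYA, hYB]
  have hdet := congrArg Matrix.det hmul
  rw [Matrix.det_mul, Matrix.det_fromBlocks_zero₁₂, Matrix.det_fromBlocks_zero₂₁] at hdet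
  rw [← Matrix.det_submatrix_equiv_self e, hG]
  simp only [Matrix.det_one, one_mul] at hdet
  rw [hdet, Matrix.det_fin_two_of]
  ring

section Abstract

variable {V : Type*} [AddCommGroup V] [Module ℝ V]

/-- Pulled back to `ℝⁿ`, an alternating `n`-form is a multiple of the determinant, so `v` need not
be independent. -/
theorem alternatingMap_sum_smul {n : ℕ} (Φ : V [⋀^Fin n]→ₗ[ℝ] ℝ) (P : Matrix (Fin n) (Fin n) ℝ)
    (v : Fin n → V) : Φ (fun i => ∑ j, P i j • v j) = P.det * Φ v := by
  let L : (Fin n → ℝ) →ₗ[ℝ] V := Fintype.linearCombination ℝ v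
  have h := (Φ.compLinearMap L).eq_smul_basis_det (Pi.basisFun ℝ (Fin n))
  have h2 : Φ (fun i => L (P.row i)) =
      Φ (fun i => L (Pi.basisFun ℝ (Fin n) i)) * (Pi.basisFun ℝ (Fin n)).det P.row :=
    congrArg (fun F : (Fin n → ℝ) [⋀^Fin n]→ₗ[ℝ] ℝ => F P.row) h
  have h3 : ∀ i, L (Pi.basisFun ℝ (Fin n) i) = v i := fun i => by
    simp [L, Fintype.linearCombination_apply]
  have h4 : (Pi.basisFun ℝ (Fin n)).det P.row = P.det := Pi.basisFun_det_apply P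
  simp only [h3, h4] at h2
  rw [mul_comm, ← h2]
  rfl

theorem det_bilin_sum_smul {n : ℕ} (T : V →ₗ[ℝ] V →ₗ[ℝ] ℝ) (P : Matrix (Fin n) (Fin n) ℝ)
    (v : Fin n → V) :
    (Matrix.of fun i j => T (∑ k, P i k • v k) (∑ k, P j k • v k)).det =
      P.det ^ 2 * (Matrix.of fun i j => T (v i) (v j)).det := by
  have : (Matrix.of fun i j => T (∑ k, P i k • v k) (∑ k, P j k • v k)) =
      P * (Matrix.of fun i j => T (v i) (v j)) * P.transpose := by
    ext i j
    simp only [Matrix.of_apply, map_sum, map_smul, LinearMap.sum_apply, LinearMap.smul_apply,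
      smul_eq_mul, Matrix.mul_apply, Matrix.transpose_apply, Finset.sum_mul, Finset.mul_sum]
    refine Finset.sum_congr rfl fun k _ => Finset.sum_congr rfl fun l _ => ?_
    ring
  rw [this, Matrix.det_mul, Matrix.det_mul, Matrix.det_transpose]
  ring

/-- A family of alternating forms that satisfies the Pfaffian row expansion for an alternating
bilinear form `B`, bordered by a linear form `ℓ` in odd degree, squares to the determinant of
`B + ℓ ⊗ ℓ`. -/
theorem sq_eq_det_of_pfaffian_expansion (Φ : ∀ n, V [⋀^Fin n]→ₗ[ℝ] ℝ)
    (B : V →ₗ[ℝ] V →ₗ[ℝ] ℝ) (ℓ : V →ₗ[ℝ] ℝ) (hB : ∀ f g, B f g = -B g f)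
    (hzero : ∀ v, Φ 0 v = 1) (hone : ∀ v, Φ 1 v = ℓ (v 0))
    (hexp : ∀ n (v : Fin (n + 2) → V), Φ (n + 2) v =
      ∑ j : Fin (n + 1), (-1) ^ (j : ℕ) * B (v 0) (v j.succ) *
          Φ n (fun k => v (j.succAbove k).succ) +
        if Odd n then ℓ (v 0) * Φ (n + 1) (fun k => v k.succ) else 0) :
    ∀ (n : ℕ) (v : Fin n → V), Φ n v ^ 2 =
      (Matrix.of fun i j => B (v i) (v j) + ℓ (v i) * ℓ (v j)).det := by
  have hBself : ∀ f, B f f = 0 := fun f => by have := hB f f; linarith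
  intro n
  induction n using Nat.twoStepInduction with
  | zero => intro v; simp [hzero]
  | one => intro v; simp [hone, hBself, sq]
  | more n ih _ =>
    -- When `v 0, v 1` are `B`-orthogonal to the rest, `Φ` gains the factor `B (v 0) (v 1)` and the
    -- determinant its square. For odd `n` the border term vanishes, since its even-degree tail
    -- expands along `v 1`.
    have hsplit : ∀ v : Fin (n + 2) → V, B (v 0) (v 1) ≠ 0 →
        (∀ k : Fin n, B (v 0) (v k.succ.succ) = 0) → (∀ k : Fin n, B (v 1) (v k.succ.succ) = 0) →
        Φ (n + 2) v ^ 2 = (Matrix.of fun i j => B (v i) (v j) + ℓ (v i) * ℓ (v j)).det := by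
      intro v ha hv0 hv1
      have hΦ : Φ (n + 2) v = B (v 0) (v 1) * Φ n (fun k => v k.succ.succ) := by
        have hodd : (if Odd n then ℓ (v 0) * Φ (n + 1) (fun k => v k.succ) else 0) = 0 := by
          split_ifs with ho
          · obtain ⟨m, rfl⟩ : ∃ m, n = m + 1 := ⟨n - 1, by have := ho.pos; omega⟩
            have hm : ¬ Odd m := by
              rw [Nat.not_odd_iff_even]; rw [Nat.odd_add_one, Nat.not_odd_iff_even] at ho; exact ho
            rw [hexp, if_neg hm, Finset.sum_eq_zero]
            · simp
            · intro j _
              rw [show (Fin.succ (0 : Fin (m + 2))) = 1 from rfl, hv1]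
              simp
          · rfl
        rw [hexp, hodd, Fin.sum_univ_succ, Finset.sum_eq_zero]
        · simp
        · intro j _
          rw [hv0]; simp
      rw [hΦ, mul_pow, ih, det_hyperbolic_block _ (fun i => ℓ (v i)) ha]
      · rfl
      · simp [hBself]
      · simp
      · simp [hB (v 1) (v 0)]
      · simp [hBself]
      · simp [hv0]
      · simp [hv1]
      · intro k; simp [hB _ (v 0), hv0]
      · intro k; simp [hB _ (v 1), hv1]
    have hnz : ∀ v : Fin (n + 2) → V, B (v 0) (v 1) ≠ 0 →
        Φ (n + 2) v ^ 2 = (Matrix.of fun i j => B (v i) (v j) + ℓ (v i) * ℓ (v j)).det := by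
      intro v ha
      -- The coefficients solve `B (v 0) w = B (v 1) w = 0` for `w = v k + c k • v 0 + d k • v 1`,
      -- `k ≥ 2`. This change of vectors is unitriangular, so neither side changes.
      let c : Fin (n + 2) → ℝ := Fin.cons 0 (Fin.cons 0 fun k => B (v 1) (v k.succ.succ) / B (v 0) (v 1))
      let d : Fin (n + 2) → ℝ := Fin.cons 0 (Fin.cons 0 fun k => -B (v 0) (v k.succ.succ) / B (v 0) (v 1))
      let P : Matrix (Fin (n + 2)) (Fin (n + 2)) ℝ := Matrix.of fun i j =>
        (if i = j then 1 else 0) + (if 0 = j then c i else 0) + (if 1 = j then d i else 0)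
      have c0 : c 0 = 0 := rfl
      have c1 : c 1 = 0 := rfl
      have d0 : d 0 = 0 := rfl
      have d1 : d 1 = 0 := rfl
      have hP : P.det = 1 := by
        rw [Matrix.det_of_isLowerTriangular]
        · refine Finset.prod_eq_one fun i _ => ?_
          simp only [P, Matrix.of_apply, if_true]
          split_ifs with h h' h'
          · simp [← h, c0, d0]
          · simp [← h, c0]
          · simp [← h', d1]
          · simp
        · intro i j hij
          have hij : i < j := hij
          have h0 : (0 : Fin (n + 2)) ≠ j := ((Fin.zero_le i).trans_lt hij).ne
          simp only [P, Matrix.of_apply, if_neg hij.ne, if_neg h0]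
          split_ifs with h
          · have : i = 0 := by subst h; exact (Fin.lt_one_iff i).1 hij
            simp [this, d0]
          · simp
      have hPv : ∀ i, ∑ j, P i j • v j = v i + c i • v 0 + d i • v 1 := by
        intro i
        simp [P, add_smul, Finset.sum_add_distrib, ite_smul]
      have hw := hsplit (fun i => ∑ j, P i j • v j) ?_ ?_ ?_
      · let T : V →ₗ[ℝ] V →ₗ[ℝ] ℝ := B + (LinearMap.mul ℝ ℝ).compl₁₂ ℓ ℓ
        have hT := det_bilin_sum_smul T P v
        rw [alternatingMap_sum_smul, hP, one_mul] at hw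
        rw [hw]
        rw [hP, one_pow, one_mul] at hT
        exact hT
      · simpa [hPv, c0, c1, d0, d1] using ha
      · intro k
        have : d k.succ.succ = -B (v 0) (v k.succ.succ) / B (v 0) (v 1) := rfl
        simp only [hPv, c0, d0, zero_smul, add_zero, map_add, map_smul, smul_eq_mul, hBself, this]
        field_simp
        ring
      · intro k
        have : c k.succ.succ = B (v 1) (v k.succ.succ) / B (v 0) (v 1) := rfl
        simp only [hPv, c1, d1, zero_smul, add_zero, map_add, map_smul, smul_eq_mul, hBself, this,
          hB (v 1) (v 0)]
        field_simp
        ring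
    intro v
    -- If `B` vanishes on `v`, the matrix is of rank at most one and of size at least two, and the
    -- recursion gives `0`. Otherwise a permutation, whose sign squares away, moves a nondegenerate
    -- pair to the front.
    by_cases hz : ∀ i j, B (v i) (v j) = 0
    · have hdet : (Matrix.of fun i j => B (v i) (v j) + ℓ (v i) * ℓ (v j)).det = 0 := by
        have := Matrix.det_mul_column (fun i => ℓ (v i)) (Matrix.of fun _ j => ℓ (v j))
        simp only [Matrix.of_apply] at this
        simp only [hz, zero_add, this]
        rw [Matrix.det_zero_of_row_eq (i := 0) (j := 1) (by simp) rfl, mul_zero]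
      have hΦ : Φ (n + 2) v = 0 := by
        rw [hexp, Finset.sum_eq_zero fun j _ => by rw [hz]; simp]
        split_ifs with ho
        · obtain ⟨m, rfl⟩ : ∃ m, n = m + 1 := ⟨n - 1, by have := ho.pos; omega⟩
          have hm : ¬ Odd m := by
            rw [Nat.not_odd_iff_even]; rw [Nat.odd_add_one, Nat.not_odd_iff_even] at ho; exact ho
          rw [hexp, if_neg hm, Finset.sum_eq_zero fun j _ => by rw [hz]; simp]
          simp
        · simp
      rw [hΦ, hdet]; simp
    · push Not at hz
      obtain ⟨i, j, hij⟩ := hz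
      have hne : i ≠ j := by rintro rfl; exact hij (hBself _)
      obtain ⟨σ, rfl, rfl⟩ := exists_perm_map_zero_map_one hne
      have h := hnz (v ∘ σ) hij
      rw [AlternatingMap.map_perm] at h
      have h2 := Matrix.det_submatrix_equiv_self σ
        (Matrix.of fun i j => B (v i) (v j) + ℓ (v i) * ℓ (v j))
      rw [← h2]
      rw [show (Matrix.of fun i j => B (v i) (v j) + ℓ (v i) * ℓ (v j)).submatrix σ σ =
        Matrix.of fun i j => B ((v ∘ σ) i) ((v ∘ σ) j) + ℓ ((v ∘ σ) i) * ℓ ((v ∘ σ) j)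
        from rfl, ← h]
      rcases Int.units_eq_one_or (Equiv.Perm.sign σ) with hs | hs <;> simp [hs]

end Abstract

/-! ### Integrals of pair products as alternating forms -/

section Kernel

variable {X : Type*} [MeasurableSpace X]

/-- A measurable antisymmetric kernel bounded by one. -/
structure IsSkewKernel (S : X → X → ℝ) : Prop where
  measurable : Measurable (Function.uncurry S)
  antisymm : ∀ x y, S x y = -S y x
  abs_le_one : ∀ x y, |S x y| ≤ 1

/-- The space of integrable functions. -/
def integrableFunctions (μ : Measure X) : Submodule ℝ (X → ℝ) where
  carrier := {f | Integrable f μ}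
  add_mem' hf hg := Integrable.add hf hg
  zero_mem' := integrable_zero _ _ _
  smul_mem' c _ hf := Integrable.smul c hf

variable {μ : Measure X} {S : X → X → ℝ}

theorem IsSkewKernel.integrable_mul (hS : IsSkewKernel S) {f g : X → ℝ} (hf : Integrable f μ)
    (hg : Integrable g μ) : Integrable (fun p : X × X => S p.1 p.2 * (f p.1 * g p.2)) (μ.prod μ) :=
  (hf.mul_prod hg).bdd_mul (c := 1) hS.measurable.aestronglyMeasurable
    (Filter.Eventually.of_forall fun p => hS.abs_le_one p.1 p.2)

theorem prod_update_apply {n : ℕ} [DecidableEq (Fin n)] (v : Fin n → integrableFunctions μ)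
    (i : Fin n) (f : integrableFunctions μ) (x : Fin n → X) :
    ∏ k, (Function.update v i f k : X → ℝ) (x k) =
      (f : X → ℝ) (x i) * ∏ k ∈ Finset.univ.erase i, (v k : X → ℝ) (x k) := by
  rw [← Finset.mul_prod_erase _ _ (Finset.mem_univ i), Function.update_self]
  congr 1
  refine Finset.prod_congr rfl fun k hk => ?_
  rw [Function.update_of_ne (Finset.ne_of_mem_erase hk)]

variable (μ) [SigmaFinite μ]

theorem integral_pi_succAbove {n : ℕ} (j : Fin (n + 1)) (H : X → (Fin n → X) → ℝ) :
    ∫ x, H (x j) (fun k => x (j.succAbove k)) ∂(Measure.pi fun _ : Fin (n + 1) => μ) =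
      ∫ p, H p.1 p.2 ∂(μ.prod (Measure.pi fun _ : Fin n => μ)) :=
  (measurePreserving_piFinSuccAbove (fun _ : Fin (n + 1) => μ) j).integral_comp'
    (fun p => H p.1 p.2)

theorem integral_pi_two_mul {n : ℕ} (j : Fin (n + 1)) (H : X → X → ℝ) (G : (Fin n → X) → ℝ) :
    ∫ x, H (x 0) (x j.succ) * G (fun k => x (j.succAbove k).succ)
        ∂(Measure.pi fun _ : Fin (n + 2) => μ) =
      (∫ p, H p.1 p.2 ∂(μ.prod μ)) * ∫ x, G x ∂(Measure.pi fun _ : Fin n => μ) := by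
  have h1 := integral_pi_succAbove μ (0 : Fin (n + 2))
    (fun y z => H y (z j) * G (fun k => z (j.succAbove k)))
  simp only [Fin.zero_succAbove] at h1
  have h2 := ((MeasurePreserving.id μ).prod
    (measurePreserving_piFinSuccAbove (fun _ : Fin (n + 1) => μ) j)).integral_comp
      (MeasurableEmbedding.prodMap MeasurableEmbedding.id
        (MeasurableEquiv.measurableEmbedding _))
      (fun p : X × X × (Fin n → X) => H p.1 p.2.1 * G p.2.2)
  have h3 := (measurePreserving_prodAssoc μ μ (Measure.pi fun _ : Fin n => μ)).integral_comp'
    (fun p : X × X × (Fin n → X) => H p.1 p.2.1 * G p.2.2)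
  rw [h1]
  refine Eq.trans h2 (h3.symm.trans ?_)
  exact integral_prod_mul (fun p : X × X => H p.1 p.2) G

variable {μ}

theorem IsSkewKernel.integrable_pairProd_mul (hS : IsSkewKernel S) {m n : ℕ}
    {f : Fin n → X → ℝ} (hf : ∀ i, Integrable (f i) μ) (e : Fin m → Fin n) :
    Integrable (fun x : Fin n → X => pairProd S (fun k => x (e k)) * ∏ i, f i (x i))
      (Measure.pi fun _ => μ) := by
  refine (Integrable.fintype_prod hf).bdd_mul (c := 1) ?_
    (Filter.Eventually.of_forall fun x => abs_pairProd_le_one hS.abs_le_one _)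
  refine Measurable.aestronglyMeasurable ?_
  exact (measurable_pairProd hS.measurable m).comp (measurable_pi_lambda _ fun k =>
    measurable_pi_apply (e k))

theorem measurePreserving_comp_perm {n : ℕ} (σ : Equiv.Perm (Fin n)) :
    MeasurePreserving (fun x : Fin n → X => x ∘ σ) (Measure.pi fun _ => μ)
      (Measure.pi fun _ => μ) :=
  measurePreserving_arrowCongr' (fun _ => μ) (fun _ => μ) σ.symm (MeasurableEquiv.refl X)
    fun _ => MeasurePreserving.id μ

/-- The alternating form `v ↦ ∫ ∏_{i < j} S (x i) (x j) ∏ i, v i (x i)`. -/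
def pairForm (μ : Measure X) [SigmaFinite μ] (hS : IsSkewKernel S) (n : ℕ) :
    integrableFunctions μ [⋀^Fin n]→ₗ[ℝ] ℝ where
  toFun v := ∫ x, pairProd S x * ∏ i, (v i : X → ℝ) (x i) ∂(Measure.pi fun _ => μ)
  map_update_add' v i f g := by
    have hint := fun h : integrableFunctions μ =>
      hS.integrable_pairProd_mul (fun k => (Function.update v i h k).2) id
    simp only [id] at hint
    rw [← integral_add (hint f) (hint g)]
    refine integral_congr_ae (Filter.Eventually.of_forall fun x => ?_)
    simp only [prod_update_apply]
    rw [Submodule.coe_add, Pi.add_apply]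
    ring
  map_update_smul' v i c f := by
    rw [smul_eq_mul, ← integral_const_mul]
    refine integral_congr_ae (Filter.Eventually.of_forall fun x => ?_)
    simp only [prod_update_apply]
    rw [Submodule.coe_smul, Pi.smul_apply, smul_eq_mul]
    ring
  map_eq_zero_of_eq' v i j h hij := by
    -- Swapping two variables that carry the same function negates the integrand but preserves the
    -- measure.
    have hmp := (measurePreserving_comp_perm (μ := μ) (Equiv.swap i j)).integral_comp
      (MeasurableEquiv.arrowCongr' (Equiv.swap i j).symm
        (MeasurableEquiv.refl X)).measurableEmbedding
      (fun x => pairProd S x * ∏ k, (v k : X → ℝ) (x k))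
    have hneg : ∀ x : Fin n → X, pairProd S (x ∘ Equiv.swap i j) *
        ∏ k, (v k : X → ℝ) ((x ∘ Equiv.swap i j) k) =
        -(pairProd S x * ∏ k, (v k : X → ℝ) (x k)) := by
      intro x
      have hv : ∀ k, v k = v (Equiv.swap i j k) := fun k => by
        rcases eq_or_ne k i with rfl | hki
        · simp [h]
        rcases eq_or_ne k j with rfl | hkj
        · simp [h]
        rw [Equiv.swap_apply_of_ne_of_ne hki hkj]
      have hp : ∏ k, (v k : X → ℝ) ((x ∘ Equiv.swap i j) k) = ∏ k, (v k : X → ℝ) (x k) := by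
        rw [← Equiv.prod_comp (Equiv.swap i j) fun k => (v k : X → ℝ) (x k)]
        exact Finset.prod_congr rfl fun k _ => by rw [hv k]; rfl
      rw [pairProd_comp_perm hS.antisymm, Equiv.Perm.sign_swap hij, hp]
      simp
    simp only [hneg, integral_neg] at hmp
    linarith

/-- The alternating bilinear form with kernel `S`. -/
def kernelForm (μ : Measure X) [SigmaFinite μ] (hS : IsSkewKernel S) :
    integrableFunctions μ →ₗ[ℝ] integrableFunctions μ →ₗ[ℝ] ℝ :=
  LinearMap.mk₂ ℝ
    (fun f g => ∫ p, S p.1 p.2 * ((f : X → ℝ) p.1 * (g : X → ℝ) p.2) ∂(μ.prod μ))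
    (fun f f' g => by
      rw [← integral_add (hS.integrable_mul f.2 g.2) (hS.integrable_mul f'.2 g.2)]
      refine integral_congr_ae (Filter.Eventually.of_forall fun p => ?_)
      simp only [Submodule.coe_add, Pi.add_apply]
      ring)
    (fun c f g => by
      rw [smul_eq_mul, ← integral_const_mul]
      refine integral_congr_ae (Filter.Eventually.of_forall fun p => ?_)
      simp only [Submodule.coe_smul, Pi.smul_apply, smul_eq_mul]
      ring)
    (fun f g g' => by
      rw [← integral_add (hS.integrable_mul f.2 g.2) (hS.integrable_mul f.2 g'.2)]
      refine integral_congr_ae (Filter.Eventually.of_forall fun p => ?_)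
      simp only [Submodule.coe_add, Pi.add_apply]
      ring)
    (fun c f g => by
      rw [smul_eq_mul, ← integral_const_mul]
      refine integral_congr_ae (Filter.Eventually.of_forall fun p => ?_)
      simp only [Submodule.coe_smul, Pi.smul_apply, smul_eq_mul]
      ring)

/-- The integral as a linear form. -/
def integralForm (μ : Measure X) : integrableFunctions μ →ₗ[ℝ] ℝ where
  toFun f := ∫ x, (f : X → ℝ) x ∂μ
  map_add' f g := integral_add f.2 g.2
  map_smul' c _ := integral_const_mul c _

theorem kernelForm_antisymm (hS : IsSkewKernel S) (f g : integrableFunctions μ) :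
    kernelForm μ hS f g = -kernelForm μ hS g f := by
  simp only [kernelForm, LinearMap.mk₂_apply]
  rw [← integral_neg, ← integral_prod_swap]
  refine integral_congr_ae (Filter.Eventually.of_forall fun p => ?_)
  simp only [Prod.fst_swap, Prod.snd_swap]
  rw [hS.antisymm]
  ring

/-- In each term of the pointwise expansion the variables separate, `(x 0, x j.succ)` or `x 0` alone
from the others, so Fubini turns it into a product of forms. -/
theorem pairForm_expand (hS : IsSkewKernel S) {n : ℕ}
    (hexp : ∀ᵐ x ∂(Measure.pi fun _ : Fin (n + 2) => μ), pairProd S x =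
      ∑ j : Fin (n + 1), (-1) ^ (j : ℕ) * S (x 0) (x j.succ) *
          pairProd S (fun k : Fin n => x (j.succAbove k).succ) +
        if Odd n then pairProd S (fun k : Fin (n + 1) => x k.succ) else 0)
    (v : Fin (n + 2) → integrableFunctions μ) :
    pairForm μ hS (n + 2) v =
      ∑ j : Fin (n + 1), (-1) ^ (j : ℕ) * kernelForm μ hS (v 0) (v j.succ) *
          pairForm μ hS n (fun k => v (j.succAbove k).succ) +
        if Odd n then integralForm μ (v 0) * pairForm μ hS (n + 1) (fun k => v k.succ) else 0 := by
  have hint : ∀ j : Fin (n + 1), Integrable (fun x : Fin (n + 2) → X =>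
      (-1 : ℝ) ^ (j : ℕ) * (S (x 0) (x j.succ) *
        (pairProd S (fun k : Fin n => x (j.succAbove k).succ) * ∏ i, (v i : X → ℝ) (x i))))
      (Measure.pi fun _ => μ) := by
    intro j
    refine Integrable.const_mul ?_ _
    refine (hS.integrable_pairProd_mul (fun i => (v i).2)
      (fun k : Fin n => (j.succAbove k).succ)).bdd_mul (c := 1) ?_
      (Filter.Eventually.of_forall fun x => hS.abs_le_one _ _)
    exact (hS.measurable.comp (g := Function.uncurry S)
      (f := fun x : Fin (n + 2) → X => (x 0, x j.succ))
      ((measurable_pi_apply _).prodMk (measurable_pi_apply _))).aestronglyMeasurable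
  have hint' : Integrable (fun x : Fin (n + 2) → X => if Odd n then
      pairProd S (fun k : Fin (n + 1) => x k.succ) * ∏ i, (v i : X → ℝ) (x i) else 0)
      (Measure.pi fun _ => μ) := by
    split_ifs
    · exact hS.integrable_pairProd_mul (fun i => (v i).2) Fin.succ
    · exact integrable_zero _ _ _
  have h1 : pairForm μ hS (n + 2) v = ∫ x, (∑ j : Fin (n + 1), (-1 : ℝ) ^ (j : ℕ) *
      (S (x 0) (x j.succ) * (pairProd S (fun k : Fin n => x (j.succAbove k).succ) *
        ∏ i, (v i : X → ℝ) (x i))) + if Odd n then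
      pairProd S (fun k : Fin (n + 1) => x k.succ) * ∏ i, (v i : X → ℝ) (x i) else 0)
      ∂(Measure.pi fun _ => μ) := by
    refine integral_congr_ae ?_
    filter_upwards [hexp] with x hx
    rw [hx, add_mul, Finset.sum_mul, ite_mul, zero_mul]
    simp only [mul_assoc]
  rw [h1, integral_add (integrable_finsetSum _ fun j _ => hint j) hint',
    integral_finsetSum _ fun j _ => hint j]
  congr 1
  · refine Finset.sum_congr rfl fun j _ => ?_
    rw [integral_const_mul, mul_assoc]
    congr 1
    refine Eq.trans ?_ (integral_pi_two_mul μ j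
      (fun y z => S y z * ((v 0 : X → ℝ) y * (v j.succ : X → ℝ) z))
      (fun x => pairProd S x * ∏ k, (v (j.succAbove k).succ : X → ℝ) (x k)))
    refine integral_congr_ae (Filter.Eventually.of_forall fun x => ?_)
    simp only [Fin.prod_univ_succ (n := n + 1), Fin.prod_univ_succAbove _ j]
    ring
  · split_ifs
    · have h2 := integral_pi_succAbove μ (0 : Fin (n + 2)) (fun y z => (v 0 : X → ℝ) y *
        (pairProd S z * ∏ k : Fin (n + 1), (v k.succ : X → ℝ) (z k)))
      rw [integral_prod_mul (v 0 : X → ℝ) fun z : Fin (n + 1) → X =>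
        pairProd S z * ∏ k : Fin (n + 1), (v k.succ : X → ℝ) (z k)] at h2
      refine Eq.trans ?_ h2
      refine integral_congr_ae (Filter.Eventually.of_forall fun x => ?_)
      simp only [Fin.prod_univ_succ (n := n + 1), Fin.zero_succAbove]
      ring
    · simp

/-- If the product over pairs satisfies the Pfaffian row expansion almost everywhere, then the
square of its integral against a product function is a determinant. -/
theorem sq_integral_pairProd_eq_det (hS : IsSkewKernel S)
    (hexp : ∀ n, ∀ᵐ x ∂(Measure.pi fun _ : Fin (n + 2) => μ), pairProd S x =
      ∑ j : Fin (n + 1), (-1) ^ (j : ℕ) * S (x 0) (x j.succ) *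
          pairProd S (fun k : Fin n => x (j.succAbove k).succ) +
        if Odd n then pairProd S (fun k : Fin (n + 1) => x k.succ) else 0)
    {n : ℕ} {f : Fin n → X → ℝ} (hf : ∀ i, Integrable (f i) μ) :
    (∫ x, pairProd S x * ∏ i, f i (x i) ∂(Measure.pi fun _ => μ)) ^ 2 =
      (Matrix.of fun i j => ∫ p, S p.1 p.2 * (f i p.1 * f j p.2) ∂(μ.prod μ) +
        (∫ x, f i x ∂μ) * ∫ x, f j x ∂μ).det :=
  sq_eq_det_of_pfaffian_expansion (pairForm μ hS) (kernelForm μ hS) (integralForm μ)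
    (kernelForm_antisymm hS) (fun v => by simp [pairForm, pairProd, measureReal_def])
    (fun v => by
      change ∫ x, pairProd S x * ∏ i, (v i : X → ℝ) (x i) ∂(Measure.pi fun _ => μ) =
        ∫ x, (v 0 : X → ℝ) x ∂μ
      have h := integral_fintype_prod_eq_prod (μ := fun _ : Fin 1 => μ) (fun i => (v i : X → ℝ))
      simpa [pairProd] using h)
    (fun n v => pairForm_expand hS (hexp n) v) n (fun i => ⟨f i, hf i⟩)

/-- Antisymmetry of the pair product turns its integral against an alternant into one against the
diagonal product. -/
theorem integral_pairProd_mul_det (hS : IsSkewKernel S) {n : ℕ} {f : Fin n → X → ℝ}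
    (hf : ∀ i, Integrable (f i) μ) :
    Integrable (fun x => pairProd S x * (Matrix.of fun i j => f j (x i)).det)
      (Measure.pi fun _ => μ) ∧
    ∫ x, pairProd S x * (Matrix.of fun i j => f j (x i)).det ∂(Measure.pi fun _ => μ) =
      n.factorial * ∫ x, pairProd S x * ∏ i, f i (x i) ∂(Measure.pi fun _ => μ) := by
  have hint : ∀ σ : Equiv.Perm (Fin n), Integrable (fun x : Fin n → X =>
      ((Equiv.Perm.sign σ : ℤ) : ℝ) * (pairProd S x * ∏ i, f (σ i) (x i)))
      (Measure.pi fun _ => μ) := fun σ =>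
    (hS.integrable_pairProd_mul (fun i => hf (σ i)) id).const_mul _
  have heq : ∀ x : Fin n → X, pairProd S x * (Matrix.of fun i j => f j (x i)).det =
      ∑ σ : Equiv.Perm (Fin n), ((Equiv.Perm.sign σ : ℤ) : ℝ) *
        (pairProd S x * ∏ i, f (σ i) (x i)) := by
    intro x
    rw [← Matrix.det_transpose, Matrix.det_apply', Finset.mul_sum]
    refine Finset.sum_congr rfl fun σ _ => ?_
    simp only [Matrix.transpose_apply, Matrix.of_apply]
    ring
  simp only [heq]
  refine ⟨integrable_finsetSum _ fun σ _ => hint σ, ?_⟩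
  rw [integral_finsetSum _ fun σ _ => hint σ]
  -- Since `pairForm` is alternating, permuting the functions produces a second sign, which cancels
  -- the Leibniz sign.
  have hterm : ∀ σ : Equiv.Perm (Fin n),
      ∫ x, ((Equiv.Perm.sign σ : ℤ) : ℝ) * (pairProd S x * ∏ i, f (σ i) (x i))
        ∂(Measure.pi fun _ => μ) =
      ∫ x, pairProd S x * ∏ i, f i (x i) ∂(Measure.pi fun _ => μ) := by
    intro σ
    let v : Fin n → integrableFunctions μ := fun i => ⟨f i, hf i⟩
    have h := (pairForm μ hS n).map_perm v σ
    rw [integral_const_mul]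
    change _ * pairForm μ hS n (v ∘ σ) = pairForm μ hS n v
    rw [h]
    rcases Int.units_eq_one_or (Equiv.Perm.sign σ) with hs | hs <;> simp [hs]
  rw [Finset.sum_congr rfl fun σ _ => hterm σ, Finset.sum_const, Finset.card_univ,
    Fintype.card_perm, Fintype.card_fin, nsmul_eq_mul]

end Kernel

/-! ### Andréief's identity for two sets of variables -/

section Andreief

variable {X : Type*} [MeasurableSpace X] {μ : Measure X} [SigmaFinite μ]

/-- Pairing `x i` with `y (ρ i)` preserves measure and turns the integrand into a product over
independent pairs. -/
theorem integral_prod_kernel_perm {n : ℕ} (h : Fin n → Fin n → X × X → ℝ)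
    (hint : ∀ i j, Integrable (h i j) (μ.prod μ)) (ρ : Equiv.Perm (Fin n)) :
    Integrable (fun p : (Fin n → X) × (Fin n → X) => ∏ i, h i (ρ i) (p.1 i, p.2 (ρ i)))
      ((Measure.pi fun _ => μ).prod (Measure.pi fun _ => μ)) ∧
    ∫ p : (Fin n → X) × (Fin n → X), ∏ i, h i (ρ i) (p.1 i, p.2 (ρ i))
      ∂((Measure.pi fun _ => μ).prod (Measure.pi fun _ => μ)) =
      ∏ i, ∫ q, h i (ρ i) q ∂(μ.prod μ) := by
  have hmp : MeasurePreserving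
      (fun p : (Fin n → X) × (Fin n → X) => fun i => (p.1 i, p.2 (ρ i)))
      ((Measure.pi fun _ => μ).prod (Measure.pi fun _ => μ)) (Measure.pi fun _ => μ.prod μ) :=
    ((measurePreserving_arrowProdEquivProdArrow X X (Fin n) (fun _ => μ) (fun _ => μ)).symm _).comp
      ((MeasurePreserving.id _).prod (measurePreserving_comp_perm ρ))
  have hemb : MeasurableEmbedding
      (fun p : (Fin n → X) × (Fin n → X) => fun i => (p.1 i, p.2 (ρ i))) :=
    (MeasurableEquiv.arrowProdEquivProdArrow X X (Fin n)).symm.measurableEmbedding.comp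
      (MeasurableEmbedding.id.prodMap (MeasurableEquiv.arrowCongr' ρ.symm
        (MeasurableEquiv.refl X)).measurableEmbedding)
  constructor
  · exact (hmp.integrable_comp_emb hemb).2 (Integrable.fintype_prod fun i => hint i (ρ i))
  · rw [← integral_fintype_prod_eq_prod]
    exact hmp.integral_comp hemb (fun q : Fin n → X × X => ∏ i, h i (ρ i) (q i))

theorem integral_det_kernel_mul_prod {n : ℕ} {K : X → X → ℝ} {f g : Fin n → X → ℝ}
    (hint : ∀ i j, Integrable (fun q : X × X => K q.1 q.2 * (f i q.1 * g j q.2)) (μ.prod μ)) :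
    Integrable (fun p : (Fin n → X) × (Fin n → X) =>
      (Matrix.of fun i j => K (p.1 i) (p.2 j)).det * ((∏ i, f i (p.1 i)) * ∏ i, g i (p.2 i)))
      ((Measure.pi fun _ => μ).prod (Measure.pi fun _ => μ)) ∧
    ∫ p : (Fin n → X) × (Fin n → X),
      (Matrix.of fun i j => K (p.1 i) (p.2 j)).det * ((∏ i, f i (p.1 i)) * ∏ i, g i (p.2 i))
      ∂((Measure.pi fun _ => μ).prod (Measure.pi fun _ => μ)) =
      (Matrix.of fun i j => ∫ q, K q.1 q.2 * (f i q.1 * g j q.2) ∂(μ.prod μ)).det := by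
  have hρ := fun ρ => integral_prod_kernel_perm
    (fun i j (q : X × X) => K q.1 q.2 * (f i q.1 * g j q.2)) hint ρ
  have heq : ∀ p : (Fin n → X) × (Fin n → X),
      (Matrix.of fun i j => K (p.1 i) (p.2 j)).det * ((∏ i, f i (p.1 i)) * ∏ i, g i (p.2 i)) =
      ∑ ρ : Equiv.Perm (Fin n), ((Equiv.Perm.sign ρ : ℤ) : ℝ) *
        ∏ i, (K (p.1 i) (p.2 (ρ i)) * (f i (p.1 i) * g (ρ i) (p.2 (ρ i)))) := by
    intro p
    rw [← Matrix.det_transpose, Matrix.det_apply', Finset.sum_mul]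
    refine Finset.sum_congr rfl fun ρ _ => ?_
    rw [Finset.prod_mul_distrib, Finset.prod_mul_distrib, Equiv.prod_comp ρ fun i => g i (p.2 i)]
    simp only [Matrix.transpose_apply, Matrix.of_apply]
    ring
  simp only [heq]
  refine ⟨integrable_finsetSum _ fun ρ _ => (hρ ρ).1.const_mul _, ?_⟩
  rw [integral_finsetSum _ fun ρ _ => (hρ ρ).1.const_mul _, ← Matrix.det_transpose,
    Matrix.det_apply']
  refine Finset.sum_congr rfl fun ρ _ => ?_
  rw [integral_const_mul, (hρ ρ).2]
  rfl

/-- The two-matrix Andréief identity. -/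
theorem integral_det_kernel_mul_det {n : ℕ} {K : X → X → ℝ} {f g : Fin n → X → ℝ}
    (hint : ∀ i j, Integrable (fun q : X × X => K q.1 q.2 * (f i q.1 * g j q.2)) (μ.prod μ)) :
    Integrable (fun p : (Fin n → X) × (Fin n → X) =>
      (Matrix.of fun i j => K (p.1 i) (p.2 j)).det *
        ((Matrix.of fun i j => f j (p.1 i)).det * (Matrix.of fun i j => g j (p.2 i)).det))
      ((Measure.pi fun _ => μ).prod (Measure.pi fun _ => μ)) ∧
    ∫ p : (Fin n → X) × (Fin n → X), (Matrix.of fun i j => K (p.1 i) (p.2 j)).det *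
        ((Matrix.of fun i j => f j (p.1 i)).det * (Matrix.of fun i j => g j (p.2 i)).det)
      ∂((Measure.pi fun _ => μ).prod (Measure.pi fun _ => μ)) =
      (n.factorial : ℝ) ^ 2 *
        (Matrix.of fun i j => ∫ q, K q.1 q.2 * (f i q.1 * g j q.2) ∂(μ.prod μ)).det := by
  have hστ := fun σ τ : Equiv.Perm (Fin n) => integral_det_kernel_mul_prod
    (K := K) (f := fun i => f (σ i)) (g := fun i => g (τ i)) fun i j => hint (σ i) (τ j)
  have heq : ∀ p : (Fin n → X) × (Fin n → X), (Matrix.of fun i j => K (p.1 i) (p.2 j)).det *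
        ((Matrix.of fun i j => f j (p.1 i)).det * (Matrix.of fun i j => g j (p.2 i)).det) =
      ∑ σ : Equiv.Perm (Fin n), ∑ τ : Equiv.Perm (Fin n),
        (((Equiv.Perm.sign σ : ℤ) : ℝ) * ((Equiv.Perm.sign τ : ℤ) : ℝ)) *
        ((Matrix.of fun i j => K (p.1 i) (p.2 j)).det *
          ((∏ i, f (σ i) (p.1 i)) * ∏ i, g (τ i) (p.2 i))) := by
    intro p
    rw [← Matrix.det_transpose (Matrix.of fun i j => f j (p.1 i)),
      ← Matrix.det_transpose (Matrix.of fun i j => g j (p.2 i)),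
      Matrix.det_apply' (Matrix.transpose (Matrix.of fun i j => f j (p.1 i))),
      Matrix.det_apply' (Matrix.transpose (Matrix.of fun i j => g j (p.2 i))),
      Finset.sum_mul_sum, Finset.mul_sum]
    refine Finset.sum_congr rfl fun σ _ => ?_
    rw [Finset.mul_sum]
    refine Finset.sum_congr rfl fun τ _ => ?_
    simp only [Matrix.transpose_apply, Matrix.of_apply]
    ring
  simp only [heq]
  refine ⟨integrable_finsetSum _ fun σ _ => integrable_finsetSum _ fun τ _ =>
    (hστ σ τ).1.const_mul _, ?_⟩
  rw [integral_finsetSum _ fun σ _ => integrable_finsetSum _ fun τ _ => (hστ σ τ).1.const_mul _]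
  set M : Matrix (Fin n) (Fin n) ℝ :=
    Matrix.of fun i j => ∫ q, K q.1 q.2 * (f i q.1 * g j q.2) ∂(μ.prod μ) with hM
  have hterm : ∀ σ : Equiv.Perm (Fin n),
      ∫ p : (Fin n → X) × (Fin n → X), ∑ τ : Equiv.Perm (Fin n),
        (((Equiv.Perm.sign σ : ℤ) : ℝ) * ((Equiv.Perm.sign τ : ℤ) : ℝ)) *
        ((Matrix.of fun i j => K (p.1 i) (p.2 j)).det *
          ((∏ i, f (σ i) (p.1 i)) * ∏ i, g (τ i) (p.2 i)))
        ∂((Measure.pi fun _ => μ).prod (Measure.pi fun _ => μ)) = n.factorial * M.det := by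
    intro σ
    rw [integral_finsetSum _ fun τ _ => (hστ σ τ).1.const_mul _]
    have : ∀ τ : Equiv.Perm (Fin n), ∫ p : (Fin n → X) × (Fin n → X),
        (((Equiv.Perm.sign σ : ℤ) : ℝ) * ((Equiv.Perm.sign τ : ℤ) : ℝ)) *
        ((Matrix.of fun i j => K (p.1 i) (p.2 j)).det *
          ((∏ i, f (σ i) (p.1 i)) * ∏ i, g (τ i) (p.2 i)))
        ∂((Measure.pi fun _ => μ).prod (Measure.pi fun _ => μ)) = M.det := by
      intro τ
      rw [integral_const_mul, (hστ σ τ).2]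
      -- `σ` permutes the rows of `M` and `τ` its columns, so the Leibniz signs cancel and all
      -- `(n!)²` terms agree.
      have h1 := Matrix.det_permute σ (M.submatrix id τ)
      rw [Matrix.det_permute', Matrix.submatrix_submatrix] at h1
      change _ * (M.submatrix (id ∘ σ) (τ ∘ id)).det = _
      rw [h1]
      rcases Int.units_eq_one_or (Equiv.Perm.sign σ) with hs | hs <;>
        rcases Int.units_eq_one_or (Equiv.Perm.sign τ) with ht | ht <;> simp [hs, ht]
    rw [Finset.sum_congr rfl fun τ _ => this τ, Finset.sum_const, Finset.card_univ,
      Fintype.card_perm, Fintype.card_fin, nsmul_eq_mul]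
  rw [Finset.sum_congr rfl fun σ _ => hterm σ, Finset.sum_const, Finset.card_univ,
    Fintype.card_perm, Fintype.card_fin, nsmul_eq_mul]
  ring

end Andreief

/-! ### Specialisation to the Laguerre weight -/

theorem ae_injective_pi (n : ℕ) : ∀ᵐ x : Fin n → ℝ, Function.Injective x := by
  have h : ∀ i j : Fin n, i ≠ j → ∀ᵐ x : Fin n → ℝ, x i ≠ x j := by
    intro i j hij
    let s : Submodule ℝ (Fin n → ℝ) :=
      LinearMap.ker (LinearMap.proj (R := ℝ) (φ := fun _ : Fin n => ℝ) i - LinearMap.proj j)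
    have hs : s ≠ ⊤ := by
      intro hs
      have : Pi.single i (1 : ℝ) ∈ s := hs ▸ Submodule.mem_top
      simp [s, hij.symm] at this
    have h0 := Measure.addHaar_submodule (volume : Measure (Fin n → ℝ)) s hs
    refine measure_mono_null (fun x hx => ?_) h0
    simp only [Set.mem_compl_iff, Set.mem_ofPred_eq, not_not] at hx
    simp [s, hx]
  have h2 : ∀ᵐ x : Fin n → ℝ, ∀ i j : Fin n, i ≠ j → x i ≠ x j := by
    refine ae_all_iff.2 fun i => ae_all_iff.2 fun j => ?_
    by_cases hij : i = j
    · simp [hij]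
    · filter_upwards [h i j hij] with x hx _ using hx
  filter_upwards [h2] with x hx i j hij
  by_contra hne
  exact hx i j hne hij

theorem isSkewKernel_schurKernel : IsSkewKernel schurKernel where
  measurable := measurable_schurKernel
  antisymm := schurKernel_antisymm
  abs_le_one := abs_schurKernel_le_one

/-- Lebesgue measure on the positive half-line. -/
abbrev volumePos : Measure ℝ := volume.restrict (Set.Ioi 0)

theorem volume_restrict_orthant (n : ℕ) :
    (volume : Measure (Fin n → ℝ)).restrict (orthant n) = Measure.pi fun _ => volumePos := by
  rw [orthant, volume_pi, Measure.restrict_pi_pi]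

theorem volume_restrict_orthant_prod (n : ℕ) :
    (volume : Measure ((Fin n → ℝ) × (Fin n → ℝ))).restrict (orthant n ×ˢ orthant n) =
      (Measure.pi fun _ => volumePos).prod (Measure.pi fun _ => volumePos) := by
  rw [Measure.volume_eq_prod, ← Measure.prod_restrict, volume_restrict_orthant]

theorem volume_restrict_quadrant :
    (volume : Measure (ℝ × ℝ)).restrict quadrant = volumePos.prod volumePos := by
  rw [quadrant, Measure.volume_eq_prod, ← Measure.prod_restrict]

theorem measurableSet_orthant (n : ℕ) : MeasurableSet (orthant n) :=
  MeasurableSet.univ_pi fun _ => measurableSet_Ioi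

theorem mem_orthant {n : ℕ} {x : Fin n → ℝ} : x ∈ orthant n ↔ ∀ i, 0 < x i := by
  simp [orthant]

theorem ae_pairProd_schurKernel_expand (n : ℕ) :
    ∀ᵐ x ∂(Measure.pi fun _ : Fin (n + 2) => volumePos), pairProd schurKernel x =
      ∑ j : Fin (n + 1), (-1) ^ (j : ℕ) * schurKernel (x 0) (x j.succ) *
          pairProd schurKernel (fun k : Fin n => x (j.succAbove k).succ) +
        if Odd n then pairProd schurKernel (fun k : Fin (n + 1) => x k.succ) else 0 := by
  rw [← volume_restrict_orthant]
  -- Coincident points, the poles of the partial fraction coefficients, form a null set.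
  filter_upwards [ae_restrict_mem (measurableSet_orthant _),
    ae_restrict_of_ae (ae_injective_pi (n + 2))] with x hx hinj
  exact pairProd_schurKernel_expand x (mem_orthant.1 hx) hinj

/-- The function `x ^ s * exp (-x)`. -/
def laguerre (s x : ℝ) : ℝ := x ^ s * Real.exp (-x)

theorem integrable_laguerre {s : ℝ} (hs : -1 < s) : Integrable (laguerre s) volumePos := by
  have h := Real.GammaIntegral_convergent (s := s + 1) (by linarith)
  refine h.congr (Filter.Eventually.of_forall fun x => ?_)
  simp [laguerre, mul_comm]

/-- The kernel `1 + (y - x) / (y + x) = 2 y / (x + y)`. -/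
def shiftedKernel (x y : ℝ) : ℝ := 1 + schurKernel x y

theorem shiftedKernel_of_pos {x y : ℝ} (hx : 0 < x) (hy : 0 < y) :
    shiftedKernel x y = 2 * y * (x + y)⁻¹ := by
  rw [shiftedKernel, schurKernel_of_pos hx hy]
  have := (add_pos hx hy).ne'
  have := (add_pos hy hx).ne'
  field_simp
  ring

theorem integral_shiftedKernel_mul {f g : ℝ → ℝ} (hf : Integrable f volumePos)
    (hg : Integrable g volumePos) :
    Integrable (fun q : ℝ × ℝ => shiftedKernel q.1 q.2 * (f q.1 * g q.2))
      (volumePos.prod volumePos) ∧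
    ∫ q, shiftedKernel q.1 q.2 * (f q.1 * g q.2) ∂(volumePos.prod volumePos) =
      ∫ q, schurKernel q.1 q.2 * (f q.1 * g q.2) ∂(volumePos.prod volumePos) +
        (∫ x, f x ∂volumePos) * ∫ x, g x ∂volumePos := by
  have h1 := hf.mul_prod hg
  have h2 := isSkewKernel_schurKernel.integrable_mul hf hg
  have heq : ∀ q : ℝ × ℝ, shiftedKernel q.1 q.2 * (f q.1 * g q.2) =
      schurKernel q.1 q.2 * (f q.1 * g q.2) + f q.1 * g q.2 := fun q => by
    rw [shiftedKernel]; ring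
  simp only [heq]
  exact ⟨h2.add h1, by rw [integral_add h2 h1, integral_prod_mul]⟩

/-- Pulling the weight out of each row leaves the Vandermonde matrix of the `x i ^ θ`. -/
theorem det_laguerre {n : ℕ} (a θ : ℝ) {x : Fin n → ℝ} (hx : ∀ i, 0 < x i) :
    (Matrix.of fun i j : Fin n => laguerre (a + θ * (j : ℕ)) (x i)).det =
      (∏ i, x i ^ a * Real.exp (-x i)) *
        ∏ i, ∏ j ∈ Finset.Ioi i, (x j ^ θ - x i ^ θ) := by
  rw [← Matrix.det_vandermonde fun i => x i ^ θ, ← Matrix.det_mul_column]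
  congr 1
  ext i j
  rw [Matrix.of_apply, Matrix.of_apply, Matrix.vandermonde_apply, laguerre,
    Real.rpow_add (hx i), Real.rpow_mul (hx i).le, Real.rpow_natCast]
  ring

theorem buresDensity_eq {n : ℕ} (a θ : ℝ) {x : Fin n → ℝ} (hx : ∀ i, 0 < x i) :
    buresDensity n a θ x = pairProd schurKernel x *
      (Matrix.of fun i j : Fin n => laguerre (a + θ * (j : ℕ)) (x i)).det := by
  rw [det_laguerre a θ hx, buresDensity, pairProd]
  simp only [Finset.prod_mul_distrib, schurKernel_of_pos (hx _) (hx _)]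
  ring

/-- The choice `b = a + 1` matters here: the extra `∏ y_j` and `2 ^ n` scale the columns of the
Cauchy matrix into `2y/(x+y)`, leaving the same weight on both sets of variables. -/
theorem cauchyDensity_eq {n : ℕ} (a θ : ℝ) {p : (Fin n → ℝ) × (Fin n → ℝ)}
    (hx : ∀ i, 0 < p.1 i) (hy : ∀ i, 0 < p.2 i) :
    2 ^ n * cauchyDensity n a (a + 1) θ p =
      (Matrix.of fun i j => shiftedKernel (p.1 i) (p.2 j)).det *
      ((Matrix.of fun i j : Fin n => laguerre (a + θ * (j : ℕ)) (p.1 i)).det *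
        (Matrix.of fun i j : Fin n => laguerre (a + θ * (j : ℕ)) (p.2 i)).det) := by
  have hK : (Matrix.of fun i j => shiftedKernel (p.1 i) (p.2 j)).det =
      (∏ j, 2 * p.2 j) * ((∏ i, ∏ j ∈ Finset.Ioi i, (p.1 j - p.1 i) * (p.2 j - p.2 i)) /
        ∏ i, ∏ j, (p.1 i + p.2 j)) := by
    rw [← det_cauchy p.1 p.2 fun i j => (add_pos (hx i) (hy j)).ne', ← Matrix.det_mul_row]
    congr 1
    ext i j
    simp [shiftedKernel_of_pos (hx i) (hy j)]
  rw [hK, det_laguerre a θ hx, det_laguerre a θ hy, cauchyDensity]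
  simp only [Real.rpow_add (hy _), Real.rpow_one, Finset.prod_mul_distrib, Finset.prod_const,
    Finset.card_univ, Fintype.card_fin]
  ring

end ThetaEnsemble

end

/-! ### The main theorem -/

open ThetaEnsemble in
theorem mainTheorem9 (a θ : ℝ) (ha : -1 < a) (hθ : 0 < θ) :
    (∀ N : ℕ,
      IntegrableOn (ThetaEnsemble.buresDensity N a θ) (ThetaEnsemble.orthant N) ∧
      IntegrableOn (ThetaEnsemble.cauchyDensity N a (a + 1) θ)
        (ThetaEnsemble.orthant N ×ˢ ThetaEnsemble.orthant N) ∧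
      ThetaEnsemble.buresZ N a θ ^ 2 = 2 ^ N * ThetaEnsemble.cauchyZ N a (a + 1) θ) ∧
    (∀ j k : ℕ, 1 ≤ j → 1 ≤ k →
      IntegrableOn (ThetaEnsemble.cauchyMomentIntegrand a (a + 1) θ j k)
        ThetaEnsemble.quadrant ∧
      IntegrableOn (ThetaEnsemble.buresMomentIntegrand a θ j k) ThetaEnsemble.quadrant ∧
      IntegrableOn (ThetaEnsemble.buresSingleIntegrand a θ j) (Set.Ioi 0) ∧
      2 * ThetaEnsemble.cauchyMoment a (a + 1) θ j k =
        ThetaEnsemble.buresMoment a θ j k +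
          ThetaEnsemble.buresSingleMoment a θ j * ThetaEnsemble.buresSingleMoment a θ k) := by
  constructor
  · intro N
    have hf : ∀ i : Fin N, Integrable (laguerre (a + θ * (i : ℕ))) volumePos := fun i =>
      integrable_laguerre (by have := mul_nonneg hθ.le (Nat.cast_nonneg (α := ℝ) (i : ℕ)); linarith)
    obtain ⟨hBint, hBval⟩ := integral_pairProd_mul_det isSkewKernel_schurKernel hf
    obtain ⟨hCint, hCval⟩ := integral_det_kernel_mul_det
      (K := shiftedKernel) fun i j => (integral_shiftedKernel_mul (hf i) (hf j)).1
    have hsq := sq_integral_pairProd_eq_det isSkewKernel_schurKernel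
      ae_pairProd_schurKernel_expand hf
    have hBae : buresDensity N a θ =ᵐ[volume.restrict (orthant N)] fun x =>
        pairProd schurKernel x *
          (Matrix.of fun i j : Fin N => laguerre (a + θ * (j : ℕ)) (x i)).det := by
      filter_upwards [ae_restrict_mem (measurableSet_orthant N)] with x hx
      exact buresDensity_eq a θ (mem_orthant.1 hx)
    have hCae : (fun p => 2 ^ N * cauchyDensity N a (a + 1) θ p)
        =ᵐ[volume.restrict (orthant N ×ˢ orthant N)] fun p =>
        (Matrix.of fun i j => shiftedKernel (p.1 i) (p.2 j)).det *
        ((Matrix.of fun i j : Fin N => laguerre (a + θ * (j : ℕ)) (p.1 i)).det *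
          (Matrix.of fun i j : Fin N => laguerre (a + θ * (j : ℕ)) (p.2 i)).det) := by
      filter_upwards [ae_restrict_mem ((measurableSet_orthant N).prod (measurableSet_orthant N))]
        with p hp
      exact cauchyDensity_eq a θ (mem_orthant.1 hp.1) (mem_orthant.1 hp.2)
    have hN : (N.factorial : ℝ) ≠ 0 := Nat.cast_ne_zero.2 N.factorial_ne_zero
    refine ⟨?_, ?_, ?_⟩
    · refine Integrable.congr ?_ hBae.symm
      rw [volume_restrict_orthant]
      exact hBint
    · have h : Integrable (fun p => 2 ^ N * cauchyDensity N a (a + 1) θ p)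
          (volume.restrict (orthant N ×ˢ orthant N)) := by
        refine Integrable.congr ?_ hCae.symm
        rw [volume_restrict_orthant_prod]
        exact hCint
      exact (integrable_const_mul_iff (IsUnit.mk0 _ (by positivity)) _).1 h
    · have hB : buresZ N a θ = ∫ x, pairProd schurKernel x *
          ∏ i : Fin N, laguerre (a + θ * (i : ℕ)) (x i) ∂(Measure.pi fun _ => volumePos) := by
        rw [buresZ, integral_congr_ae hBae, volume_restrict_orthant, hBval]
        field_simp
      have hC : 2 ^ N * cauchyZ N a (a + 1) θ = (Matrix.of fun i j : Fin N =>
          ∫ q, shiftedKernel q.1 q.2 * (laguerre (a + θ * (i : ℕ)) q.1 *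
            laguerre (a + θ * (j : ℕ)) q.2) ∂(volumePos.prod volumePos)).det := by
        rw [cauchyZ, mul_left_comm, ← integral_const_mul, integral_congr_ae hCae,
          volume_restrict_orthant_prod, hCval]
        field_simp
      rw [hB, hC, hsq]
      -- The two determinants agree entrywise, by `2y/(x+y) = 1 + (y-x)/(y+x)`.
      congr 1
      ext i j
      exact (integral_shiftedKernel_mul (hf i) (hf j)).2.symm
  · intro j k hj hk
    have hexp : ∀ m : ℕ, 1 ≤ m → Integrable (laguerre (a + θ * ((m : ℝ) - 1))) volumePos := by
      intro m hm
      have h1 : (1 : ℝ) ≤ m := by exact_mod_cast hm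
      exact integrable_laguerre (by have := mul_nonneg hθ.le (sub_nonneg.2 h1); linarith)
    have hfj := hexp j hj
    have hfk := hexp k hk
    obtain ⟨hint, hval⟩ := integral_shiftedKernel_mul hfj hfk
    have hquad : MeasurableSet quadrant := measurableSet_Ioi.prod measurableSet_Ioi
    have hCae : (fun p => 2 * cauchyMomentIntegrand a (a + 1) θ j k p)
        =ᵐ[volume.restrict quadrant] fun q => shiftedKernel q.1 q.2 *
          (laguerre (a + θ * ((j : ℝ) - 1)) q.1 * laguerre (a + θ * ((k : ℝ) - 1)) q.2) := by
      filter_upwards [ae_restrict_mem hquad] with p hp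
      have hx : 0 < p.1 := hp.1
      have hy : 0 < p.2 := hp.2
      rw [shiftedKernel_of_pos hx hy, cauchyMomentIntegrand, laguerre, laguerre, neg_add,
        Real.exp_add, add_right_comm a 1, Real.rpow_add_one hy.ne']
      ring
    have hBae : buresMomentIntegrand a θ j k
        =ᵐ[volume.restrict quadrant] fun q => schurKernel q.1 q.2 *
          (laguerre (a + θ * ((j : ℝ) - 1)) q.1 * laguerre (a + θ * ((k : ℝ) - 1)) q.2) := by
      filter_upwards [ae_restrict_mem hquad] with p hp
      rw [schurKernel_of_pos hp.1 hp.2, buresMomentIntegrand, laguerre, laguerre, neg_add,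
        Real.exp_add]
      ring
    refine ⟨?_, ?_, hfj, ?_⟩
    · have h : Integrable (fun p => 2 * cauchyMomentIntegrand a (a + 1) θ j k p)
          (volume.restrict quadrant) := by
        refine Integrable.congr ?_ hCae.symm
        rw [volume_restrict_quadrant]
        exact hint
      exact (integrable_const_mul_iff (IsUnit.mk0 _ (by norm_num)) _).1 h
    · refine Integrable.congr ?_ hBae.symm
      rw [volume_restrict_quadrant]
      exact isSkewKernel_schurKernel.integrable_mul hfj hfk
    · rw [cauchyMoment, ← integral_const_mul, integral_congr_ae hCae, buresMoment,
        integral_congr_ae hBae, volume_restrict_quadrant, hval]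
      rfl
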